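/- For $n\in\mathbb N=\{0,1,2,\dots\}$ let $[n]=\{1,\dots,n\}$. Let $\Sigma$ be a finite alphabet and let $f\colon \mathrm{Dom}(f)\to\{0,1\}$ with $\mathrm{Dom}(f)\subseteq\Sigma^n$ be a (possibly partial) Boolean function. $R_\epsilon(f)$ is the least $T$ such that some probability distribution over decision trees making at most $T$ queries to the input computes $f$ with error probability at most $\epsilon$ on every $x\in\mathrm{Dom}(f)$. $Q_\epsilon(f)$ is the least number of queries of a quantum query algorithm (input-independent unitaries alternating with the query operator $|i,b,w\rangle\mapsto|i,b+x_i \bmod |\Sigma|,w\rangle$, with idle states fixed by the query operator, followed by a measurement) that computes $f$ with error probability at most $\epsilon$ on every $x\in\mathrm{Dom}(f)$. Write $R=R_{1/3}$ and $Q=Q_{1/3}$. A group action on $[n]$ is a subgroup $G$ of the group of permutations of $[n]$; $f$ is symmetric under $G$ if for all $x\in\mathrm{Dom}(f)$ and $\pi\in G$ we have $x\circ\pi\in\mathrm{Dom}(f)$ and $f(x\circ\pi)=f(x)$, where $(x\circ\pi)_i=x_{\pi(i)}$. Let $D_{n,r}\subseteq[n]^n$ be the set of strings with at most $r$ distinct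 symbols, and regard $G$ as a subset of $[n]^n$. For $r<n$ let $\mathrm{cost}(G,r)=Q(h)$, where $h$ has domain $G\cup D_{n,r}$, $h=1$ on $G$ and $h=0$ on $D_{n,r}$; for $r\ge n$ let $\mathrm{cost}(G,r)=\infty$. A collection $\mathcal G$ of group actions, each on some $[n]$, is well-shuffling with power $a$ (an integer $a\ge1$) if there is an integer $b\ge1$ such that $\mathrm{cost}(G,r)\ge r^{1/a}/b$ for all $G\in\mathcal G$ and all $r\in\mathbb N$. **Theorem.** (1) There is a universal constant $c\in\mathbb N$, $c\ge1$, such that for all $n\in\mathbb N$, every finite alphabet $\Sigma$, every partial Boolean function $f$ with $\mathrm{Dom}(f)\subseteq\Sigma^n$ and every group action $G$ on $[n]$ under which $f$ is symmetric, $$R(f)\le\min\{\,r\in\mathbb N:\mathrm{cost}(G,r)\ge c\,Q(f)\,\}.$$ (2) Consequently, if $\mathcal G$ is a collection of group actions that is well-shuffling with power $a$, then there is a constant $C$ (depending only on $\mathcal G$ and $a$) such that $R(f)\le C\,Q(f)^a$ for every partial Boolean function $f$, over any finite alphabet, that is symmetric under some $G\in\mathcal G$. -/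

import Mathlib

open scoped ENNReal

/-! ### Randomized query algorithms -/

/-- Deterministic query algorithms (decision trees) on inputs in `A ^ n`: a tree either outputs a
bit, or queries a position `i` and continues according to the symbol read there. -/
inductive DecisionTree (n : ℕ) (A : Type) : Type
  | leaf (out : Bool) : DecisionTree n A
  | query (i : Fin n) (next : A → DecisionTree n A) : DecisionTree n A

namespace DecisionTree

/-- The output of the tree on the input `x`. -/
def eval {n : ℕ} {A : Type} (x : Fin n → A) : DecisionTree n A → Bool
  | leaf out => out
  | query i next => eval x (next (x i))

/-- The worst-case number of queries made by the tree. -/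
def depth {n : ℕ} {A : Type} [Fintype A] : DecisionTree n A → ℕ
  | leaf _ => 0
  | query _ next => 1 + Finset.univ.sup fun a => depth (next a)

end DecisionTree

/-- A randomized algorithm (a probability distribution over decision trees) computes the partial
Boolean function `f` to worst-case error `ε`. -/
def RandomizedComputes {n : ℕ} {A : Type} (μ : PMF (DecisionTree n A))
    (f : (Fin n → A) →. Bool) (ε : ℝ) : Prop :=
  ∀ (x : Fin n → A) (hx : x ∈ f.Dom), (μ.toOuterMeasure {t | t.eval x ≠ f.fn x hx}).toReal ≤ ε

/-- `R_ε(f)`: the least `T` such that some randomized algorithm, all of whose decision trees make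
at most `T` queries, computes `f` to worst-case error `ε`. -/
noncomputable def randomizedQueryComplexity {n : ℕ} {A : Type} [Fintype A] (ε : ℝ)
    (f : (Fin n → A) →. Bool) : ℕ∞ :=
  ⨅ (T : ℕ) (_ : ∃ μ : PMF (DecisionTree n A),
    (∀ t ∈ μ.support, t.depth ≤ T) ∧ RandomizedComputes μ f ε), (T : ℕ∞)

/-! ### Quantum query algorithms -/

/-- Computational basis states of a quantum query algorithm on inputs in `A ^ n` with workspace
basis `W`: `(some (i, b), w)` is `|i, b, w⟩` with query register `i`, answer register
`b ∈ {0, …, |A| - 1}` and workspace `w`; in the states `(none, w)` the query register is idle. -/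
abbrev QueryBasis (n : ℕ) (A : Type) [Fintype A] (W : Type) : Type :=
  Option (Fin n × Fin (Fintype.card A)) × W

/-- The query operation on basis states: `|i, b, w⟩ ↦ |i, b + x_i mod |A|, w⟩`, where the symbols
of the alphabet are identified with `{0, …, |A| - 1}` by `label`; idle states are fixed. -/
def oracleMap {n : ℕ} {A : Type} [Fintype A] {W : Type} (label : A ≃ Fin (Fintype.card A))
    (x : Fin n → A) : QueryBasis n A W → QueryBasis n A W
  | (none, w) => (none, w)
  | (some (i, b), w) => (some (i, b + label (x i)), w)

/-- The query operator `O_x`, the linear extension of `oracleMap`. -/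
def oracleMatrix {n : ℕ} {A : Type} [Fintype A] {W : Type} [DecidableEq W]
    (label : A ≃ Fin (Fintype.card A)) (x : Fin n → A) :
    Matrix (QueryBasis n A W) (QueryBasis n A W) ℂ :=
  Matrix.of fun s s' => if s = oracleMap label x s' then 1 else 0

/-- A quantum query algorithm on inputs in `A ^ n`: it starts in a basis state, applies
`U_0, O_x, U_1, O_x, …, O_x, U_T` with `T = queries` and unitaries `U_t` that do not depend on the
input, measures in the computational basis, and outputs a bit depending on the outcome. -/
structure QuantumAlgorithm (n : ℕ) (A : Type) [Fintype A] where
  W : Type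
  [fintypeW : Fintype W]
  [decidableEqW : DecidableEq W]
  label : A ≃ Fin (Fintype.card A)
  queries : ℕ
  start : QueryBasis n A W
  U : ℕ → Matrix.unitaryGroup (QueryBasis n A W) ℂ
  output : QueryBasis n A W → Bool

namespace QuantumAlgorithm

attribute [instance] QuantumAlgorithm.fintypeW QuantumAlgorithm.decidableEqW

/-- The state on the input `x` after `t` queries and the unitary following the last of them. -/
noncomputable def state {n : ℕ} {A : Type} [Fintype A] (Q : QuantumAlgorithm n A)
    (x : Fin n → A) : ℕ → QueryBasis n A Q.W → ℂ
  | 0 => (Q.U 0).1.mulVec (Pi.single Q.start 1)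
  | t + 1 => (Q.U (t + 1)).1.mulVec ((oracleMatrix Q.label x).mulVec (Q.state x t))

/-- The probability that the algorithm outputs the bit `v` on the input `x`. -/
noncomputable def outputProb {n : ℕ} {A : Type} [Fintype A] (Q : QuantumAlgorithm n A)
    (x : Fin n → A) (v : Bool) : ℝ :=
  ∑ s with Q.output s = v, ‖Q.state x Q.queries s‖ ^ 2

/-- The algorithm computes the partial Boolean function `f` to worst-case error `ε`. -/
def Computes {n : ℕ} {A : Type} [Fintype A] (Q : QuantumAlgorithm n A)
    (f : (Fin n → A) →. Bool) (ε : ℝ) : Prop :=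
  ∀ (x : Fin n → A) (hx : x ∈ f.Dom), Q.outputProb x (!f.fn x hx) ≤ ε

end QuantumAlgorithm

/-- `Q_ε(f)`: the least number of queries of a quantum algorithm that computes `f` to worst-case
error `ε`. -/
noncomputable def quantumQueryComplexity {n : ℕ} {A : Type} [Fintype A] (ε : ℝ)
    (f : (Fin n → A) →. Bool) : ℕ∞ :=
  ⨅ (Q : QuantumAlgorithm n A) (_ : Q.Computes f ε), (Q.queries : ℕ∞)

/-! ### Symmetric functions, cost and well-shuffling collections -/

/-- The partial function `f` is symmetric under the group action `G` on `[n]`: for `x ∈ Dom(f)`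
and `π ∈ G`, also `x ∘ π ∈ Dom(f)`, and `f(x ∘ π) = f(x)`. -/
def SymmetricUnder {n : ℕ} {A : Type} (f : (Fin n → A) →. Bool)
    (G : Subgroup (Equiv.Perm (Fin n))) : Prop :=
  ∀ (x : Fin n → A) (hx : x ∈ f.Dom), ∀ π ∈ G,
    ∃ h : x ∘ π ∈ f.Dom, f.fn (x ∘ π) h = f.fn x hx

/-- `D_{n,r}`: the strings in `[n]^n` with at most `r` distinct symbols. -/
def smallRange (n r : ℕ) : Set (Fin n → Fin n) :=
  {α | (Set.range α).ncard ≤ r}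

/-- The group action `G` as a set of strings in `[n]^n`. -/
def permStrings {n : ℕ} (G : Subgroup (Equiv.Perm (Fin n))) : Set (Fin n → Fin n) :=
  {α | ∃ π ∈ G, α = π}

open Classical in
/-- The partial function with domain `G ∪ D_{n,r}` that is `1` on `G` and `0` on `D_{n,r}`
(for `r < n`, when these sets are disjoint). -/
noncomputable def distinguish {n : ℕ} (G : Subgroup (Equiv.Perm (Fin n))) (r : ℕ) :
    (Fin n → Fin n) →. Bool :=
  fun α => ⟨α ∈ permStrings G ∪ smallRange n r, fun _ => decide (α ∈ permStrings G)⟩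

/-- `cost_ε(G, r)`: the quantum query complexity of distinguishing `G` from `D_{n,r}` to
worst-case error `ε` if `r < n`, and `∞` if `r ≥ n`. -/
noncomputable def cost {n : ℕ} (ε : ℝ) (G : Subgroup (Equiv.Perm (Fin n))) (r : ℕ) : ℕ∞ :=
  if r < n then quantumQueryComplexity ε (distinguish G r) else ⊤

/-- A collection of group actions, each on some `[n]`. -/
abbrev ActionCollection : Type :=
  Set (Σ n : ℕ, Subgroup (Equiv.Perm (Fin n)))

/-- The collection is well-shuffling with power `a`: for some `b`, `cost(G, r) ≥ r^{1/a} / b` for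
all `G` in the collection and all `r`. -/
def WellShuffling (𝒢 : ActionCollection) (a : ℕ) : Prop :=
  0 < a ∧ ∃ b : ℕ, 0 < b ∧ ∀ (n : ℕ) (G : Subgroup (Equiv.Perm (Fin n))), ⟨n, G⟩ ∈ 𝒢 →
    ∀ r : ℕ, ENNReal.ofReal ((r : ℝ) ^ ((1 : ℝ) / a) / b) ≤ ((cost (1 / 3) G r : ℕ∞) : ℝ≥0∞)

/-- `f ∈ F(𝒢)`: the partial Boolean function `f` is symmetric under some action in `𝒢`. -/
def InSymmetricClass (𝒢 : ActionCollection) {n : ℕ} {A : Type} (f : (Fin n → A) →. Bool) : Prop :=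
  ∃ G : Subgroup (Equiv.Perm (Fin n)), ⟨n, G⟩ ∈ 𝒢 ∧ SymmetricUnder f G

/-!
Let a quantum algorithm compute `f`, amplified to error `1 / 9`. A classical algorithm that draws a
string `α` with at most `r` symbols from some distribution `μ` can learn all of `x ∘ α` with `r`
queries to `x`, and can then guess `f x` from `x ∘ α` without further queries. The minimax theorem
for finite games (`exists_stdSimplex_le_or_lt`) leaves two cases.

* Some mixture of such strategies has error at most `1 / 3` on every `x` in the domain of `f`. Then
  `R(f) ≤ r`.
* For some distribution `ν` on the domain of `f`, every such strategy has error more than `1 / 3`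
  on average over `x ∼ ν`. In particular, so does the output of the quantum algorithm on `x ∘ α`,
  for every `α` with at most `r` symbols, since an optimal deterministic guess from `x ∘ α` does at
  least as well (`exists_deterministic_guess`). If `α` is a permutation in `G` instead, then by
  symmetry that output equals `f x` except with probability `1 / 9`. So the quantum algorithm that
  takes the string `α` as its input, draws `x ∼ ν`, and checks three times whether the amplified
  algorithm for `f` gives `f x` on `x ∘ α` distinguishes `G` from `D_{n,r}`
  (`quantumQueryComplexity_distinguish_le`), with at most `162 Q(f)` queries.

Hence `R(f) ≤ r` whenever `cost(G, r) ≥ 163 Q(f)`, unless `Q(f) = 0`; in that case `f` is constant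
and `R(f) = 0`. The bound for well-shuffling collections is the case `r = (163 b Q(f)) ^ a`.

The quantum algorithms needed are obtained from closure properties of the set of acceptance
probabilities `IsAcceptProb label T` of algorithms with `T` queries. Sequential composition with
deferred measurement (`QuantumAlgorithm.exists_sequential`) gives branching on the output of an
earlier algorithm (`IsAcceptProb.ite`), hence majority votes and, with a biased coin as the earlier
algorithm, convex combinations; it also gives the simulation of decision trees, by which `Q(f)` is
finite. Finally, `IsAcceptProb.substitute` simulates a query to `x ∘ α` by two queries to `α`, the
second of which erases the position learned in the first.
-/

/-! ### Unitary matrices from norm-preserving maps -/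

theorem star_dotProduct_self_eq_sum_norm_sq {B : Type*} [Fintype B] (ψ : B → ℂ) :
    star ψ ⬝ᵥ ψ = ((∑ b, ‖ψ b‖ ^ 2 : ℝ) : ℂ) := by
  simp [dotProduct, Complex.conj_mul']

theorem sum_norm_sq_unitary_mulVec {B : Type*} [Fintype B] [DecidableEq B]
    (U : Matrix.unitaryGroup B ℂ) (ψ : B → ℂ) :
    ∑ b, ‖U.1.mulVec ψ b‖ ^ 2 = ∑ b, ‖ψ b‖ ^ 2 := by
  have h : star (U.1.mulVec ψ) ⬝ᵥ U.1.mulVec ψ = star ψ ⬝ᵥ ψ := by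
    rw [Matrix.star_mulVec, ← Matrix.dotProduct_mulVec, Matrix.mulVec_mulVec,
      ← Matrix.star_eq_conjTranspose, Matrix.UnitaryGroup.star_mul_self, Matrix.one_mulVec]
  rw [star_dotProduct_self_eq_sum_norm_sq, star_dotProduct_self_eq_sum_norm_sq] at h
  exact_mod_cast h

/-- By polarization, a matrix preserving the Euclidean norm is unitary. -/
theorem mem_unitaryGroup_of_sum_norm_sq {B : Type*} [Fintype B] [DecidableEq B]
    (M : Matrix B B ℂ) (h : ∀ ψ : B → ℂ, ∑ b, ‖M.mulVec ψ b‖ ^ 2 = ∑ b, ‖ψ b‖ ^ 2) :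
    M ∈ Matrix.unitaryGroup B ℂ := by
  have hn : ∀ x : EuclideanSpace ℂ B, ‖Matrix.toEuclideanLin M x‖ = ‖x‖ := by
    intro x
    rw [EuclideanSpace.norm_eq, EuclideanSpace.norm_eq]
    congr 1
    exact h x.ofLp
  rw [LinearMap.norm_map_iff_inner_map_map] at hn
  rw [Matrix.mem_unitaryGroup_iff']
  ext i j
  have := hn (EuclideanSpace.single i 1) (EuclideanSpace.single j 1)
  simp only [EuclideanSpace.inner_eq_star_dotProduct] at this
  simpa [Matrix.toEuclideanLin, Matrix.mul_apply, dotProduct, Matrix.one_apply, Pi.single_apply,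
    mul_comm, eq_comm] using this

/-- The unitary matrix of a linear map that preserves the Euclidean norm. -/
noncomputable def unitaryOfLinear {B : Type*} [Fintype B] [DecidableEq B]
    (L : (B → ℂ) →ₗ[ℂ] (B → ℂ)) (h : ∀ ψ, ∑ b, ‖L ψ b‖ ^ 2 = ∑ b, ‖ψ b‖ ^ 2) :
    Matrix.unitaryGroup B ℂ :=
  ⟨LinearMap.toMatrix' L, mem_unitaryGroup_of_sum_norm_sq _ fun ψ => by
    simpa only [LinearMap.toMatrix'_mulVec] using h ψ⟩

theorem unitaryOfLinear_mulVec {B : Type*} [Fintype B] [DecidableEq B]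
    (L : (B → ℂ) →ₗ[ℂ] (B → ℂ)) (h : ∀ ψ, ∑ b, ‖L ψ b‖ ^ 2 = ∑ b, ‖ψ b‖ ^ 2) (ψ : B → ℂ) :
    (unitaryOfLinear L h).1.mulVec ψ = L ψ := by
  simp only [unitaryOfLinear, LinearMap.toMatrix'_mulVec]

/-! ### Relabelling basis states -/

/-- The linear map `|b⟩ ↦ |f b⟩` induced by a map of basis states. -/
def pushState {B C : Type*} [Fintype B] [DecidableEq C] (f : B → C) : (B → ℂ) →ₗ[ℂ] (C → ℂ) where
  toFun ψ c := ∑ b, if c = f b then ψ b else 0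
  map_add' ψ φ := by
    ext c
    simp only [Pi.add_apply, ← Finset.sum_add_distrib]
    exact Finset.sum_congr rfl fun b _ => by split_ifs <;> simp
  map_smul' a ψ := by
    ext c
    simp only [Pi.smul_apply, smul_eq_mul, Finset.mul_sum, RingHom.id_apply, mul_ite, mul_zero]

theorem pushState_apply {B C : Type*} [Fintype B] [DecidableEq C] (f : B → C) (ψ : B → ℂ) (c : C) :
    pushState f ψ c = ∑ b, if c = f b then ψ b else 0 := rfl

theorem pushState_single {B C : Type*} [Fintype B] [DecidableEq B] [DecidableEq C] (f : B → C)
    (b : B) (a : ℂ) : pushState f (Pi.single b a) = Pi.single (f b) a := by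
  ext c
  rw [pushState_apply, Finset.sum_eq_single b] <;> simp +contextual [Pi.single_apply]

theorem pushState_comp {B C D : Type*} [Fintype B] [Fintype C] [DecidableEq C] [DecidableEq D]
    (g : C → D) (f : B → C) (ψ : B → ℂ) :
    pushState g (pushState f ψ) = pushState (g ∘ f) ψ := by
  classical
  have : (pushState g).comp (pushState f) = pushState (g ∘ f) :=
    LinearMap.pi_ext fun b a => by simp [pushState_single]
  exact LinearMap.congr_fun this ψ

theorem pushState_apply_of_injective {B C : Type*} [Fintype B] [DecidableEq C] {f : B → C}
    (hf : Function.Injective f) (ψ : B → ℂ) (b : B) : pushState f ψ (f b) = ψ b := by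
  classical
  simp [pushState_apply, hf.eq_iff]

theorem pushState_apply_of_notMem_range {B C : Type*} [Fintype B] [DecidableEq C] {f : B → C}
    (ψ : B → ℂ) {c : C} (hc : c ∉ Set.range f) : pushState f ψ c = 0 :=
  Finset.sum_eq_zero fun b _ => if_neg fun h => hc ⟨b, h.symm⟩

/-- Summation over the basis states of the target with a given property, of a function that
vanishes outside the range of the relabelling. -/
theorem sum_filter_norm_sq_pushState {B C : Type*} [Fintype B] [Fintype C] [DecidableEq C]
    {f : B → C} (hf : Function.Injective f) (ψ : B → ℂ) (p : C → Prop) [DecidablePred p] :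
    ∑ c with p c, ‖pushState f ψ c‖ ^ 2 = ∑ b with p (f b), ‖ψ b‖ ^ 2 := by
  classical
  rw [Finset.sum_filter, Finset.sum_filter]
  symm
  rw [← Finset.sum_subset (Finset.subset_univ (Finset.univ.image f)) fun c _ hc => by
      rw [pushState_apply_of_notMem_range ψ (by simpa using hc)]; simp,
    Finset.sum_image hf.injOn]
  exact Finset.sum_congr rfl fun b _ => by rw [pushState_apply_of_injective hf]

theorem sum_norm_sq_pushState {B C : Type*} [Fintype B] [Fintype C] [DecidableEq C]
    {f : B → C} (hf : Function.Injective f) (ψ : B → ℂ) :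
    ∑ c, ‖pushState f ψ c‖ ^ 2 = ∑ b, ‖ψ b‖ ^ 2 := by
  simpa using sum_filter_norm_sq_pushState hf ψ fun _ => True

/-- The permutation matrix of a bijection of basis states. -/
noncomputable def permUnitary {B : Type*} [Fintype B] [DecidableEq B] (σ : Equiv.Perm B) :
    Matrix.unitaryGroup B ℂ :=
  unitaryOfLinear (pushState σ) (sum_norm_sq_pushState σ.injective)

theorem permUnitary_mulVec {B : Type*} [Fintype B] [DecidableEq B] (σ : Equiv.Perm B)
    (ψ : B → ℂ) : (permUnitary σ).1.mulVec ψ = pushState σ ψ :=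
  unitaryOfLinear_mulVec _ _ _

/-! ### Block-diagonal unitaries on part of the basis -/

open Classical in
/-- The linear map that acts by `U i` on the `i`-th block, where the blocks are embedded disjointly
into the basis `C` by `j`, and as the identity on the remaining basis states. -/
noncomputable def blockLinear {ι : Type*} {B : ι → Type*} {C : Type*} [∀ i, Fintype (B i)]
    [∀ i, DecidableEq (B i)] (j : (Σ i, B i) → C)
    (U : ∀ i, Matrix.unitaryGroup (B i) ℂ) : (C → ℂ) →ₗ[ℂ] (C → ℂ) where
  toFun ψ := Function.extend j (fun p => (U p.1).1.mulVec (fun b => ψ (j ⟨p.1, b⟩)) p.2) ψ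
  map_add' ψ φ := by
    ext c
    by_cases hc : ∃ p, j p = c
    · simp only [Function.extend_def, dif_pos hc, Pi.add_apply]
      rw [← Pi.add_apply, ← Matrix.mulVec_add]
      rfl
    · simp [hc]
  map_smul' a ψ := by
    ext c
    by_cases hc : ∃ p, j p = c
    · simp only [Function.extend_def, dif_pos hc, Pi.smul_apply, RingHom.id_apply]
      rw [← Pi.smul_apply, ← Matrix.mulVec_smul]
      rfl
    · simp [hc]

theorem sum_norm_sq_blockLinear {ι : Type*} {B : ι → Type*} {C : Type*} [Fintype ι]
    [∀ i, Fintype (B i)] [∀ i, DecidableEq (B i)] [Fintype C] {j : (Σ i, B i) → C}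
    (hj : Function.Injective j) (U : ∀ i, Matrix.unitaryGroup (B i) ℂ) (ψ : C → ℂ) :
    ∑ c, ‖blockLinear j U ψ c‖ ^ 2 = ∑ c, ‖ψ c‖ ^ 2 := by
  classical
  rw [← Finset.sum_add_sum_compl (Finset.univ.image j),
    ← Finset.sum_add_sum_compl (Finset.univ.image j) fun c => ‖ψ c‖ ^ 2]
  congr 1
  · rw [Finset.sum_image hj.injOn, Finset.sum_image hj.injOn, Fintype.sum_sigma,
      Fintype.sum_sigma]
    refine Finset.sum_congr rfl fun i _ => ?_
    simp only [blockLinear, LinearMap.coe_mk, AddHom.coe_mk, hj.extend_apply]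
    exact sum_norm_sq_unitary_mulVec (U i) fun b => ψ (j ⟨i, b⟩)
  · refine Finset.sum_congr rfl fun c hc => ?_
    have hc' : ¬∃ p, j p = c := by simpa using hc
    simp only [blockLinear, LinearMap.coe_mk, AddHom.coe_mk, Function.extend_apply' _ _ _ hc']

/-- The unitary matrix of `blockLinear`. -/
noncomputable def blockUnitary {ι : Type*} {B : ι → Type*} {C : Type*} [Fintype ι]
    [∀ i, Fintype (B i)] [∀ i, DecidableEq (B i)] [Fintype C] [DecidableEq C]
    {j : (Σ i, B i) → C} (hj : Function.Injective j) (U : ∀ i, Matrix.unitaryGroup (B i) ℂ) :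
    Matrix.unitaryGroup C ℂ :=
  unitaryOfLinear (blockLinear j U) (sum_norm_sq_blockLinear hj U)

theorem blockUnitary_mulVec_pushState {ι : Type*} {B : ι → Type*} {C : Type*} [Fintype ι]
    [∀ i, Fintype (B i)] [∀ i, DecidableEq (B i)] [Fintype C] [DecidableEq C]
    {j : (Σ i, B i) → C} (hj : Function.Injective j) (U : ∀ i, Matrix.unitaryGroup (B i) ℂ)
    (φ : ∀ i, B i → ℂ) :
    (blockUnitary hj U).1.mulVec (pushState j fun p => φ p.1 p.2) =
      pushState j fun p => (U p.1).1.mulVec (φ p.1) p.2 := by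
  classical
  rw [blockUnitary, unitaryOfLinear_mulVec]
  ext c
  by_cases hc : ∃ p, j p = c
  · obtain ⟨p, rfl⟩ := hc
    simp only [blockLinear, LinearMap.coe_mk, AddHom.coe_mk, hj.extend_apply,
      pushState_apply_of_injective hj]
  · simp only [blockLinear, LinearMap.coe_mk, AddHom.coe_mk, Function.extend_apply' _ _ _ hc]
    rw [pushState_apply_of_notMem_range _ hc, pushState_apply_of_notMem_range _ hc]

/-- The unitary acting by `U` on the basis states in the range of the embedding `j`, and as the
identity on all others. -/
noncomputable def extendUnitary {B C : Type*} [Fintype B] [DecidableEq B] [Fintype C]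
    [DecidableEq C] {j : B → C} (hj : Function.Injective j) (U : Matrix.unitaryGroup B ℂ) :
    Matrix.unitaryGroup C ℂ :=
  blockUnitary (ι := Unit) (B := fun _ => B) (j := fun p => j p.2)
    (fun _ _ h => Sigma.ext rfl (heq_of_eq (hj h))) fun _ => U

theorem extendUnitary_mulVec_pushState {B C : Type*} [Fintype B] [DecidableEq B] [Fintype C]
    [DecidableEq C] {j : B → C} (hj : Function.Injective j) (U : Matrix.unitaryGroup B ℂ)
    (φ : B → ℂ) :
    (extendUnitary hj U).1.mulVec (pushState j φ) = pushState j (U.1.mulVec φ) := by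
  have h : ∀ χ : B → ℂ, pushState j χ =
      pushState (B := Σ _ : Unit, B) (fun p => j p.2) fun p => χ p.2 := fun χ => by
    ext c
    simp [pushState_apply, Fintype.sum_sigma]
  rw [h, h]
  exact blockUnitary_mulVec_pushState (ι := Unit) (B := fun _ => B) (j := fun p => j p.2) _ _
    fun _ => φ

/-! ### States of quantum query algorithms -/

theorem oracleMatrix_mulVec {n : ℕ} {A : Type} [Fintype A] {W : Type} [Fintype W] [DecidableEq W]
    (label : A ≃ Fin (Fintype.card A)) (x : Fin n → A) (ψ : QueryBasis n A W → ℂ) :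
    (oracleMatrix label x).mulVec ψ = pushState (oracleMap label x) ψ := by
  ext s
  simp [oracleMatrix, Matrix.mulVec, dotProduct, pushState_apply]

theorem oracleMap_injective {n : ℕ} {A : Type} [Fintype A] {W : Type}
    (label : A ≃ Fin (Fintype.card A)) (x : Fin n → A) :
    Function.Injective (oracleMap (W := W) label x) := by
  rintro ⟨_ | ⟨i, b⟩, w⟩ ⟨_ | ⟨i', b'⟩, w'⟩ h
  · simpa [oracleMap] using h
  · simp [oracleMap] at h
  · simp [oracleMap] at h
  · simp only [oracleMap, Prod.mk.injEq, Option.some.injEq] at h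
    obtain ⟨⟨rfl, h⟩, rfl⟩ := h
    have : NeZero (Fintype.card A) := ⟨(b.pos).ne'⟩
    rw [add_left_injective _ h]

/-- The evolution of a quantum query algorithm with the given unitaries and starting state, as in
`QuantumAlgorithm.state`. -/
noncomputable def evolve {n : ℕ} {A : Type} [Fintype A] {W : Type} [Fintype W] [DecidableEq W]
    (label : A ≃ Fin (Fintype.card A)) (U : ℕ → Matrix.unitaryGroup (QueryBasis n A W) ℂ)
    (start : QueryBasis n A W) (x : Fin n → A) : ℕ → QueryBasis n A W → ℂ
  | 0 => (U 0).1.mulVec (Pi.single start 1)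
  | t + 1 => (U (t + 1)).1.mulVec (pushState (oracleMap label x) (evolve label U start x t))

theorem QuantumAlgorithm.state_eq_evolve {n : ℕ} {A : Type} [Fintype A] (Q : QuantumAlgorithm n A)
    (x : Fin n → A) (t : ℕ) : Q.state x t = evolve Q.label Q.U Q.start x t := by
  induction t with
  | zero => rfl
  | succ t ih => rw [QuantumAlgorithm.state, oracleMatrix_mulVec, ih, evolve]

theorem QuantumAlgorithm.sum_norm_sq_state {n : ℕ} {A : Type} [Fintype A]
    (Q : QuantumAlgorithm n A) (x : Fin n → A) (t : ℕ) : ∑ s, ‖Q.state x t s‖ ^ 2 = 1 := by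
  induction t with
  | zero =>
    rw [QuantumAlgorithm.state, sum_norm_sq_unitary_mulVec]
    simp [Pi.single_apply, apply_ite]
  | succ t ih =>
    rw [QuantumAlgorithm.state, sum_norm_sq_unitary_mulVec, oracleMatrix_mulVec,
      sum_norm_sq_pushState (oracleMap_injective _ _), ih]

theorem QuantumAlgorithm.outputProb_add_outputProb_not {n : ℕ} {A : Type} [Fintype A]
    (Q : QuantumAlgorithm n A) (x : Fin n → A) (v : Bool) :
    Q.outputProb x v + Q.outputProb x (!v) = 1 := by
  rw [← Q.sum_norm_sq_state x Q.queries, outputProb, outputProb,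
    ← Finset.sum_filter_add_sum_filter_not Finset.univ (fun s => Q.output s = v)]
  simp only [Bool.eq_not]

theorem QuantumAlgorithm.outputProb_nonneg {n : ℕ} {A : Type} [Fintype A]
    (Q : QuantumAlgorithm n A) (x : Fin n → A) (v : Bool) : 0 ≤ Q.outputProb x v :=
  Finset.sum_nonneg fun _ _ => by positivity

/-! ### Sequential composition of quantum query algorithms -/

namespace SequentialComposition

variable {n : ℕ} {A : Type} [Fintype A]

/-- The basis states used by the first stage. -/
def inFirst {W₁ : Type} {W₂ : QueryBasis n A W₁ → Type} (s : QueryBasis n A W₁) :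
    QueryBasis n A (W₁ ⊕ Σ s, W₂ s) :=
  (s.1, Sum.inl s.2)

/-- The basis states used by the second stage; the outcome of the first stage is kept in the
workspace. -/
def inSecond {W₁ : Type} {W₂ : QueryBasis n A W₁ → Type} (p : Σ s, QueryBasis n A (W₂ s)) :
    QueryBasis n A (W₁ ⊕ Σ s, W₂ s) :=
  (p.2.1, Sum.inr ⟨p.1, p.2.2⟩)

theorem inFirst_injective {W₁ : Type} {W₂ : QueryBasis n A W₁ → Type} :
    Function.Injective (inFirst (W₂ := W₂)) := by
  rintro ⟨r, w⟩ ⟨r', w'⟩ h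
  simpa [inFirst] using h

theorem inSecond_injective {W₁ : Type} {W₂ : QueryBasis n A W₁ → Type} :
    Function.Injective (inSecond (W₂ := W₂)) := by
  rintro ⟨s, r, w⟩ ⟨s', r', w'⟩ h
  simp only [inSecond, Prod.mk.injEq, Sum.inr.injEq, Sigma.mk.injEq] at h
  obtain ⟨rfl, rfl, h⟩ := h
  obtain rfl := eq_of_heq h
  rfl

open Classical in
/-- The involution of basis states that exchanges the outcome `s` of the first stage with the
starting state of the second stage for this outcome. -/
noncomputable def switchStage {W₁ : Type} {W₂ : QueryBasis n A W₁ → Type}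
    (start : ∀ s, QueryBasis n A (W₂ s)) : Equiv.Perm (QueryBasis n A (W₁ ⊕ Σ s, W₂ s)) :=
  Function.Involutive.toPerm
    (fun
      | (r, Sum.inl w) => ((start (r, w)).1, Sum.inr ⟨(r, w), (start (r, w)).2⟩)
      | (r, Sum.inr p) =>
        if (r, p.2) = start p.1 then (p.1.1, Sum.inl p.1.2) else (r, Sum.inr p)) <| by
    rintro ⟨r, w | ⟨s, w⟩⟩
    · simp
    · by_cases h : (r, w) = start s
      · simp [← h]
      · simp [h]

theorem oracleMap_inFirst {W₁ : Type} {W₂ : QueryBasis n A W₁ → Type}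
    (label : A ≃ Fin (Fintype.card A)) (x : Fin n → A) :
    oracleMap label x ∘ inFirst (W₂ := W₂) = inFirst ∘ oracleMap label x := by
  ext1 ⟨_ | _, w⟩ <;> rfl

theorem oracleMap_inSecond {W₁ : Type} {W₂ : QueryBasis n A W₁ → Type}
    (label : A ≃ Fin (Fintype.card A)) (x : Fin n → A) :
    oracleMap label x ∘ inSecond (W₂ := W₂) =
      inSecond ∘ fun p => ⟨p.1, oracleMap label x p.2⟩ := by
  ext1 ⟨s, _ | _, w⟩ <;> rfl

theorem pushState_fiberwise_single {ι : Type*} {B : ι → Type*} [Fintype ι] [DecidableEq ι]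
    [∀ i, DecidableEq (B i)] (f : ∀ i, B i) (ψ : ι → ℂ) :
    pushState (fun i => (⟨i, f i⟩ : Σ i, B i)) ψ =
      fun p => ψ p.1 * (Pi.single (f p.1) 1 : B p.1 → ℂ) p.2 := by
  ext ⟨i, b⟩
  rw [pushState_apply, Finset.sum_eq_single i]
  · simp [Pi.single_apply]
  · intro i' _ h
    exact if_neg fun h' => h (Sigma.mk.inj h').1.symm
  · simp

theorem pushState_fiberwise {ι : Type*} {B : ι → Type*} [Fintype ι] [∀ i, Fintype (B i)]
    [DecidableEq ι] [∀ i, DecidableEq (B i)] (f : ∀ i, B i → B i) (φ : ∀ i, B i → ℂ) :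
    pushState (fun p : Σ i, B i => (⟨p.1, f p.1 p.2⟩ : Σ i, B i)) (fun p => φ p.1 p.2) =
      fun p => pushState (f p.1) (φ p.1) p.2 := by
  ext ⟨i, b⟩
  rw [pushState_apply, Fintype.sum_sigma, Finset.sum_eq_single i]
  · simp [pushState_apply]
  · intro i' _ h
    exact Finset.sum_eq_zero fun b' _ => if_neg fun h' => h (Sigma.mk.inj h').1.symm
  · simp

section Evolution

variable {W₁ : Type} {W₂ : QueryBasis n A W₁ → Type} [Fintype W₁] [DecidableEq W₁]
  [∀ s, Fintype (W₂ s)] [∀ s, DecidableEq (W₂ s)] [DecidableEq (W₁ ⊕ Σ s, W₂ s)]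
  (label : A ≃ Fin (Fintype.card A)) (S : ℕ)
  (U₁ : ℕ → Matrix.unitaryGroup (QueryBasis n A W₁) ℂ) (start₁ : QueryBasis n A W₁)
  (U₂ : ∀ s, ℕ → Matrix.unitaryGroup (QueryBasis n A (W₂ s)) ℂ)
  (start₂ : ∀ s, QueryBasis n A (W₂ s))

/-- The unitaries of the algorithm that runs a first stage with `S` queries and then, on its
outcome `s`, the second stage for `s`. Instead of measuring after the first stage, its outcome is
kept in the workspace. -/
noncomputable def unitaries (t : ℕ) :
    Matrix.unitaryGroup (QueryBasis n A (W₁ ⊕ Σ s, W₂ s)) ℂ :=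
  if t < S then extendUnitary inFirst_injective (U₁ t)
  else if t = S then
    blockUnitary inSecond_injective (fun s => U₂ s 0) * permUnitary (switchStage start₂) *
      extendUnitary inFirst_injective (U₁ t)
  else blockUnitary inSecond_injective fun s => U₂ s (t - S)

theorem evolve_of_lt (x : Fin n → A) (t : ℕ) (ht : t < S) :
    evolve label (unitaries S U₁ U₂ start₂) (inFirst start₁) x t =
      pushState inFirst (evolve label U₁ start₁ x t) := by
  induction t with
  | zero => rw [evolve, unitaries, if_pos ht, ← pushState_single, extendUnitary_mulVec_pushState,
      evolve]
  | succ t ih =>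
    rw [evolve, ih (by lia), unitaries, if_pos ht, pushState_comp, oracleMap_inFirst,
      ← pushState_comp, extendUnitary_mulVec_pushState, evolve]

theorem evolve_switch (x : Fin n → A) :
    evolve label (unitaries S U₁ U₂ start₂) (inFirst start₁) x S =
      pushState inSecond fun p =>
        evolve label U₁ start₁ x S p.1 * evolve label (U₂ p.1) (start₂ p.1) x 0 p.2 := by
  -- just before the switch, the state is that of the first stage
  have key : evolve label (unitaries S U₁ U₂ start₂) (inFirst start₁) x S =
      (blockUnitary inSecond_injective (fun s => U₂ s 0)).1.mulVec
        (pushState (switchStage start₂) (pushState inFirst (evolve label U₁ start₁ x S))) := by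
    rw [← permUnitary_mulVec]
    have hS : unitaries S U₁ U₂ start₂ S =
        blockUnitary inSecond_injective (fun s => U₂ s 0) * permUnitary (switchStage start₂) *
          extendUnitary inFirst_injective (U₁ S) := by
      simp [unitaries]
    rcases S with _ | t
    · rw [evolve, evolve, hS, ← extendUnitary_mulVec_pushState inFirst_injective, pushState_single,
        Matrix.mulVec_mulVec, Matrix.mulVec_mulVec]
      rfl
    · rw [evolve, evolve_of_lt _ _ _ _ _ _ _ _ (by lia), hS, pushState_comp, oracleMap_inFirst,
        ← pushState_comp, evolve, ← extendUnitary_mulVec_pushState inFirst_injective,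
        Matrix.mulVec_mulVec, Matrix.mulVec_mulVec]
      rfl
  have h : switchStage start₂ ∘ inFirst =
      inSecond ∘ fun s => (⟨s, start₂ s⟩ : Σ s, QueryBasis n A (W₂ s)) := rfl
  rw [key, pushState_comp, h, ← pushState_comp, pushState_fiberwise_single]
  refine (blockUnitary_mulVec_pushState inSecond_injective _ fun s b =>
    evolve label U₁ start₁ x S s * (Pi.single (start₂ s) 1 : _ → ℂ) b).trans ?_
  congr 1
  ext ⟨s, b⟩
  exact congrFun (Matrix.mulVec_smul (U₂ s 0).1 (evolve label U₁ start₁ x S s)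
    (Pi.single (start₂ s) 1)) b

theorem evolve_add (x : Fin n → A) (t : ℕ) :
    evolve label (unitaries S U₁ U₂ start₂) (inFirst start₁) x (S + t) =
      pushState inSecond fun p =>
        evolve label U₁ start₁ x S p.1 * evolve label (U₂ p.1) (start₂ p.1) x t p.2 := by
  induction t with
  | zero => exact evolve_switch label S U₁ start₁ U₂ start₂ x
  | succ t ih =>
    have hU : unitaries S U₁ U₂ start₂ (S + t + 1) =
        blockUnitary inSecond_injective fun s => U₂ s (t + 1) := by
      rw [unitaries, if_neg (by lia), if_neg (by lia), add_assoc, Nat.add_sub_cancel_left]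
    rw [← add_assoc, evolve, ih, pushState_comp, oracleMap_inSecond, ← pushState_comp,
      pushState_fiberwise (fun s => oracleMap (W := W₂ s) label x)
        fun s b => evolve label U₁ start₁ x S s * evolve label (U₂ s) (start₂ s) x t b, hU]
    refine (blockUnitary_mulVec_pushState inSecond_injective _ fun s =>
      pushState (oracleMap label x) fun b =>
        evolve label U₁ start₁ x S s * evolve label (U₂ s) (start₂ s) x t b).trans ?_
    congr 1
    ext ⟨s, b⟩
    have h₂ : (fun b => evolve label U₁ start₁ x S s * evolve label (U₂ s) (start₂ s) x t b) =
      evolve label U₁ start₁ x S s • evolve label (U₂ s) (start₂ s) x t := rfl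
    simp only [h₂, map_smul, Matrix.mulVec_smul, evolve]
    rfl

end Evolution

end SequentialComposition

open SequentialComposition in
/-- One may run `Q₁` and then, on the measured outcome `s`, run `Q₂ s`. -/
theorem QuantumAlgorithm.exists_sequential {n : ℕ} {A : Type} [Fintype A]
    (Q₁ : QuantumAlgorithm n A) (Q₂ : QueryBasis n A Q₁.W → QuantumAlgorithm n A) (T : ℕ)
    (hlabel : ∀ s, (Q₂ s).label = Q₁.label) (hT : ∀ s, (Q₂ s).queries = T) :
    ∃ Q : QuantumAlgorithm n A, Q.label = Q₁.label ∧ Q.queries = Q₁.queries + T ∧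
      ∀ x v, Q.outputProb x v =
        ∑ s, ‖Q₁.state x Q₁.queries s‖ ^ 2 * (Q₂ s).outputProb x v := by
  let dec : DecidableEq (Q₁.W ⊕ Σ s, (Q₂ s).W) := Classical.decEq _
  refine ⟨{ W := Q₁.W ⊕ Σ s, (Q₂ s).W
            decidableEqW := dec
            label := Q₁.label
            queries := Q₁.queries + T
            start := inFirst Q₁.start
            U := @unitaries n A _ Q₁.W (fun s => (Q₂ s).W) _ _ _ _ dec Q₁.queries
              Q₁.U (fun s => (Q₂ s).U) fun s => (Q₂ s).start
            output
              | (_, Sum.inl _) => false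
              | (r, Sum.inr p) => (Q₂ p.1).output (r, p.2) }, rfl, rfl, fun x v => ?_⟩
  rw [outputProb, state_eq_evolve]
  simp only
  have h := @evolve_add n A _ Q₁.W (fun s => (Q₂ s).W) _ _ _ _ dec Q₁.label
    Q₁.queries Q₁.U Q₁.start (fun s => (Q₂ s).U) (fun s => (Q₂ s).start) x T
  rw [h]
  refine (sum_filter_norm_sq_pushState inSecond_injective _ _).trans ?_
  rw [Finset.sum_filter, Fintype.sum_sigma]
  refine Finset.sum_congr rfl fun s _ => ?_
  rw [outputProb, Finset.sum_filter, Finset.mul_sum, hT, state_eq_evolve, state_eq_evolve, hlabel]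
  refine Finset.sum_congr rfl fun b _ => ?_
  simp only [norm_mul, mul_pow, mul_ite, mul_zero]
  rfl

/-! ### Substituting a queried string of positions into a fixed input -/

namespace Substitution

variable {n : ℕ} {A : Type} [Fintype A] {W : Type} [NeZero (Fintype.card (Fin n))]

/-- The basis states of an algorithm on `A ^ n` inside those of an algorithm on `[n] ^ n`: the
answer register moves to the workspace, and the new answer register is cleared. -/
def embed : QueryBasis n A W → QueryBasis n (Fin n) (Option (Fin (Fintype.card A)) × W)
  | (none, w) => (none, (none, w))
  | (some (i, b), w) => (some (i, 0), (some b, w))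

theorem embed_injective : Function.Injective (embed (n := n) (A := A) (W := W)) := by
  rintro ⟨_ | ⟨i, b⟩, w⟩ ⟨_ | ⟨i', b'⟩, w'⟩ h <;> simp_all [embed]

/-- The bijection of basis states that adds to the stored answer the symbol of `x` at the position
in the answer register, and negates this register, so that repeating the query clears it. -/
def addSymbol (label' : Fin n ≃ Fin (Fintype.card (Fin n))) (label : A ≃ Fin (Fintype.card A))
    (x : Fin n → A) :
    Equiv.Perm (QueryBasis n (Fin n) (Option (Fin (Fintype.card A)) × W)) where
  toFun
    | (some (i, c), (some b, w)) => (some (i, -c), (some (b + label (x (label'.symm c))), w))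
    | s => s
  invFun
    | (some (i, c), (some b, w)) => (some (i, -c), (some (b - label (x (label'.symm (-c)))), w))
    | s => s
  left_inv := by
    rintro ⟨_ | ⟨i, c⟩, _ | b, w⟩ <;> simp
    have : NeZero (Fintype.card A) := ⟨b.pos.ne'⟩
    simp
  right_inv := by
    rintro ⟨_ | ⟨i, c⟩, _ | b, w⟩ <;> simp
    have : NeZero (Fintype.card A) := ⟨b.pos.ne'⟩
    simp

theorem oracleMap_addSymbol_oracleMap_embed (label' : Fin n ≃ Fin (Fintype.card (Fin n)))
    (label : A ≃ Fin (Fintype.card A)) (x : Fin n → A) (α : Fin n → Fin n) :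
    oracleMap label' α ∘ addSymbol label' label x ∘ oracleMap label' α ∘ embed (W := W) =
      embed ∘ oracleMap label (x ∘ α) := by
  ext1 ⟨_ | ⟨i, b⟩, w⟩
  · rfl
  · simp [oracleMap, embed, addSymbol]

variable [Fintype W] [DecidableEq W]

theorem evolve_two_mul (label' : Fin n ≃ Fin (Fintype.card (Fin n)))
    (label : A ≃ Fin (Fintype.card A)) (U : ℕ → Matrix.unitaryGroup (QueryBasis n A W) ℂ)
    (start : QueryBasis n A W) (x : Fin n → A) (α : Fin n → Fin n) (t : ℕ) :
    evolve label'
        (fun k => if k % 2 = 0 then extendUnitary embed_injective (U (k / 2))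
          else permUnitary (addSymbol label' label x))
        (embed start) α (2 * t) =
      pushState embed (evolve label U start (x ∘ α) t) := by
  induction t with
  | zero =>
    rw [mul_zero, evolve, evolve, if_pos (Nat.zero_mod 2), ← pushState_single,
      extendUnitary_mulVec_pushState]
  | succ t ih =>
    rw [show 2 * (t + 1) = 2 * t + 1 + 1 by ring, evolve, evolve, ih,
      if_pos (by lia), if_neg (by lia), show (2 * t + 1 + 1) / 2 = t + 1 by lia,
      permUnitary_mulVec, pushState_comp, pushState_comp, pushState_comp, Function.comp_assoc,
      Function.comp_assoc, oracleMap_addSymbol_oracleMap_embed, ← pushState_comp,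
      extendUnitary_mulVec_pushState, evolve]

end Substitution

/-! ### Acceptance probabilities of quantum query algorithms -/

/-- `p` is the probability of the output `1`, as a function of the input, of some quantum query
algorithm that makes `T` queries and identifies symbols with numbers by `label`. -/
def IsAcceptProb {n : ℕ} {A : Type} [Fintype A] (label : A ≃ Fin (Fintype.card A)) (T : ℕ)
    (p : (Fin n → A) → ℝ) : Prop :=
  ∃ Q : QuantumAlgorithm n A, Q.label = label ∧ Q.queries = T ∧ ∀ x, Q.outputProb x true = p x

/-- `p` is the acceptance probability of a quantum query algorithm making `2 T` queries to `α`
that simulates one making `T` queries to `x ∘ α`. -/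
theorem IsAcceptProb.substitute {n : ℕ} [NeZero (Fintype.card (Fin n))] {A : Type} [Fintype A]
    {label : A ≃ Fin (Fintype.card A)} {T : ℕ} {p : (Fin n → A) → ℝ}
    (hp : IsAcceptProb label T p) (label' : Fin n ≃ Fin (Fintype.card (Fin n))) (x : Fin n → A) :
    IsAcceptProb label' (2 * T) fun α => p (x ∘ α) := by
  classical
  obtain ⟨Q, rfl, rfl, hp⟩ := hp
  refine ⟨{ W := Option (Fin (Fintype.card A)) × Q.W
            label := label'
            queries := 2 * Q.queries
            start := Substitution.embed Q.start
            U := fun k => if k % 2 = 0 then extendUnitary Substitution.embed_injective (Q.U (k / 2))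
              else permUnitary (Substitution.addSymbol label' Q.label x)
            output := Function.extend Substitution.embed Q.output fun _ => false },
    rfl, rfl, fun α => ?_⟩
  rw [QuantumAlgorithm.outputProb, QuantumAlgorithm.state_eq_evolve]
  simp only
  rw [Substitution.evolve_two_mul, ← hp, QuantumAlgorithm.outputProb]
  refine (sum_filter_norm_sq_pushState Substitution.embed_injective _ _).trans ?_
  simp only [Substitution.embed_injective.extend_apply, QuantumAlgorithm.state_eq_evolve]

section AcceptProb

variable {n : ℕ} {A : Type} [Fintype A] {label : A ≃ Fin (Fintype.card A)}

theorem QuantumAlgorithm.outputProb_le_one (Q : QuantumAlgorithm n A) (x : Fin n → A) (v : Bool) :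
    Q.outputProb x v ≤ 1 := by
  linarith [Q.outputProb_add_outputProb_not x v, Q.outputProb_nonneg x !v]

theorem IsAcceptProb.mem_Icc {T : ℕ} {p : (Fin n → A) → ℝ} (hp : IsAcceptProb label T p)
    (x : Fin n → A) : p x ∈ Set.Icc 0 1 := by
  obtain ⟨Q, -, -, hp⟩ := hp
  exact ⟨hp x ▸ Q.outputProb_nonneg x true, hp x ▸ Q.outputProb_le_one x true⟩

/-- Run one algorithm, and depending on its output continue with one of two others. -/
theorem IsAcceptProb.ite {S T : ℕ} {p q r : (Fin n → A) → ℝ} (hp : IsAcceptProb label S p)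
    (hq : IsAcceptProb label T q) (hr : IsAcceptProb label T r) :
    IsAcceptProb label (S + T) fun x => p x * q x + (1 - p x) * r x := by
  obtain ⟨P, rfl, rfl, hp⟩ := hp
  obtain ⟨Q, hQl, rfl, hq⟩ := hq
  obtain ⟨R, hRl, hRT, hr⟩ := hr
  obtain ⟨N, hN, hNT, h⟩ := P.exists_sequential (fun s => if P.output s = true then Q else R)
    Q.queries (fun s => by split_ifs <;> assumption)
    (fun s => by split_ifs <;> simp [hRT])
  refine ⟨N, hN, hNT, fun x => ?_⟩
  have h₁ : 1 - p x = ∑ s with ¬P.output s = true, ‖P.state x P.queries s‖ ^ 2 := by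
    rw [← hp, ← P.outputProb_add_outputProb_not x true, add_sub_cancel_left,
      QuantumAlgorithm.outputProb]
    simp
  change N.outputProb x true = p x * q x + (1 - p x) * r x
  rw [h, h₁, ← hp, QuantumAlgorithm.outputProb, Finset.sum_mul, Finset.sum_mul,
    ← Finset.sum_filter_add_sum_filter_not Finset.univ (fun s => P.output s = true)]
  congr 1
  · refine Finset.sum_congr rfl fun s hs => ?_
    rw [if_pos (Finset.mem_filter.1 hs).2, hq]
  · refine Finset.sum_congr rfl fun s hs => ?_
    rw [if_neg (Finset.mem_filter.1 hs).2, hr]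

theorem IsAcceptProb.congr {T : ℕ} {p q : (Fin n → A) → ℝ} (hp : IsAcceptProb label T p)
    (h : ∀ x, p x = q x) : IsAcceptProb label T q :=
  funext h ▸ hp

/-- The rotation of the plane with cosine `c` and sine `s`. -/
noncomputable def planeRotation (c s : ℝ) (h : c ^ 2 + s ^ 2 = 1) : Matrix.unitaryGroup Bool ℂ :=
  ⟨Matrix.of fun
      | true, true => (c : ℂ)
      | true, false => -(s : ℂ)
      | false, true => s
      | false, false => c, by
    have h' : (c : ℂ) * c + s * s = 1 := by rw [← sq, ← sq]; exact_mod_cast h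
    rw [Matrix.mem_unitaryGroup_iff']
    ext i j
    cases i <;> cases j <;> simp [Matrix.mul_apply, ← h'] <;> ring⟩

/-- Without queries one may accept with any given probability. -/
theorem isAcceptProb_const {a : ℝ} (ha : a ∈ Set.Icc (0 : ℝ) 1) :
    IsAcceptProb (n := n) label 0 fun _ => a := by
  have h : √a ^ 2 + √(1 - a) ^ 2 = 1 := by
    rw [Real.sq_sqrt ha.1, Real.sq_sqrt (sub_nonneg.2 ha.2)]; ring
  have hj : Function.Injective fun b : Bool => ((none, b) : QueryBasis n A Bool) :=
    fun _ _ h => (Prod.mk.inj h).2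
  refine ⟨{ W := Bool
            label := label
            queries := 0
            start := (none, true)
            U := fun _ => extendUnitary hj (planeRotation _ _ h)
            output := Prod.snd }, rfl, rfl, fun x => ?_⟩
  rw [QuantumAlgorithm.outputProb]
  simp only [QuantumAlgorithm.state]
  rw [← pushState_single (fun b : Bool => ((none, b) : QueryBasis n A Bool)) true,
    extendUnitary_mulVec_pushState]
  refine (sum_filter_norm_sq_pushState hj _ _).trans ?_
  rw [Finset.sum_filter, Fintype.sum_bool]
  simp [planeRotation, Complex.norm_real, Real.sq_sqrt ha.1]

/-- Queries may be wasted. -/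
theorem IsAcceptProb.mono {S T : ℕ} {p : (Fin n → A) → ℝ} (hp : IsAcceptProb label S p)
    (hST : S ≤ T) : IsAcceptProb label T p := by
  -- an algorithm that makes `T - S` queries in an idle state
  have hidle : IsAcceptProb (n := n) label (T - S) fun x => (QuantumAlgorithm.outputProb
      { W := Unit, label := label, queries := T - S, start := (none, ()), U := 1,
        output := fun _ => true : QuantumAlgorithm n A} x true) := ⟨_, rfl, rfl, fun _ => rfl⟩
  have h := hidle.ite hp hp
  rw [Nat.sub_add_cancel hST] at h
  exact h.congr fun x => by ring

theorem IsAcceptProb.and {S T : ℕ} {p q : (Fin n → A) → ℝ} (hp : IsAcceptProb label S p)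
    (hq : IsAcceptProb label T q) : IsAcceptProb label (S + T) fun x => p x * q x :=
  (hp.ite hq ((isAcceptProb_const (a := 0) (by simp)).mono (Nat.zero_le T))).congr
    fun x => by ring

theorem IsAcceptProb.not {T : ℕ} {p : (Fin n → A) → ℝ} (hp : IsAcceptProb label T p) :
    IsAcceptProb label T fun x => 1 - p x :=
  (hp.ite (T := 0) (isAcceptProb_const (a := 0) (by simp)) (isAcceptProb_const (a := 1) (by simp))).congr
    fun x => by ring

/-- The majority vote of three independent runs. -/
theorem IsAcceptProb.majority {T : ℕ} {p : (Fin n → A) → ℝ} (hp : IsAcceptProb label T p) :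
    IsAcceptProb label (3 * T) fun x => 3 * p x ^ 2 - 2 * p x ^ 3 := by
  have h := hp.ite (hp.not.and hp.not).not (hp.and hp)
  rw [show T + (T + T) = 3 * T by ring] at h
  exact h.congr fun x => by ring

theorem convex_isAcceptProb (T : ℕ) : Convex ℝ {p : (Fin n → A) → ℝ | IsAcceptProb label T p} := by
  intro p hp q hq a b ha hb hab
  have h := (isAcceptProb_const (n := n) (label := label) ⟨ha, by linarith⟩).ite hp hq
  rw [zero_add] at h
  refine h.congr fun x => ?_
  simp [← hab]

/-- Quantum query algorithms simulate decision trees. -/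
theorem DecisionTree.isAcceptProb_eval (label : A ≃ Fin (Fintype.card A)) (t : DecisionTree n A) :
    IsAcceptProb label t.depth fun x => if t.eval x = true then 1 else 0 := by
  induction t with
  | leaf out =>
    exact (isAcceptProb_const (a := if out = true then 1 else 0) (by split_ifs <;> simp)).congr
      fun x => rfl
  | query i next ih =>
    by_cases hA : IsEmpty A
    · exact ((isAcceptProb_const (a := 0) (by simp)).mono (Nat.zero_le _)).congr
        fun x => (hA.false (x i)).elim
    rw [not_isEmpty_iff] at hA
    have : NeZero (Fintype.card A) := ⟨Fintype.card_ne_zero⟩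
    have hd : ∀ a, (next a).depth ≤ Finset.univ.sup fun a => (next a).depth := fun a =>
      Finset.le_sup (f := fun a => (next a).depth) (Finset.mem_univ a)
    choose R hRl hRT hR using fun a => (ih a).mono (hd a)
    -- a single query to `i`, whose answer is read off the final basis state
    let P : QuantumAlgorithm n A :=
      { W := Unit, label := label, queries := 1, start := (some (i, 0), ()), U := 1,
        output := fun _ => true }
    obtain ⟨N, hN, hNT, h⟩ := P.exists_sequential
      (fun
        | (none, _) => R (Classical.arbitrary A)
        | (some (_, b), _) => R (label.symm b))
      _ (by rintro ⟨_ | _, _⟩ <;> exact hRl _) (by rintro ⟨_ | _, _⟩ <;> exact hRT _)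
    refine ⟨N, hN, hNT, fun x => ?_⟩
    have hP : P.state x P.queries = Pi.single (some (i, label (x i)), ()) 1 := by
      rw [QuantumAlgorithm.state_eq_evolve]
      simp only [P, evolve, Pi.one_apply, OneMemClass.coe_one, Matrix.one_mulVec]
      rw [pushState_single]
      simp [oracleMap]
    rw [h, hP, Finset.sum_eq_single (some (i, label (x i)), ())]
    · simp [hR, DecisionTree.eval]
      rfl
    · intro s _ hs
      simp [hs]
    · simp

end AcceptProb

/-! ### Finite two-player games -/

/-- The minimax theorem for finite zero-sum games: for every threshold, either the row player can
keep the expected payoff at most `c`, or the column player can keep it above `c`. -/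
theorem exists_stdSimplex_le_or_lt {S X : Type*} [Fintype S] [Fintype X] [Nonempty X]
    (M : S → X → ℝ) (c : ℝ) :
    (∃ μ ∈ stdSimplex ℝ S, ∀ x, ∑ s, μ s * M s x ≤ c) ∨
      ∃ ν ∈ stdSimplex ℝ X, ∀ s, c < ∑ x, ν x * M s x := by
  classical
  rcases isEmpty_or_nonempty S with hS | ⟨⟨s₀⟩⟩
  · exact Or.inr ⟨_, single_mem_stdSimplex ℝ (Classical.arbitrary X), fun s => hS.elim s⟩
  let F (μ : S → ℝ) : (X → ℝ) →ₗ[ℝ] ℝ :=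
    { toFun := fun ν => ∑ s, ∑ x, μ s * (ν x * M s x)
      map_add' := fun ν ν' => by simp [add_mul, mul_add, Finset.sum_add_distrib]
      map_smul' := fun a ν => by simp [Finset.mul_sum, mul_left_comm, mul_assoc] }
  let F' (ν : X → ℝ) : (S → ℝ) →ₗ[ℝ] ℝ :=
    { toFun := fun μ => ∑ s, ∑ x, μ s * (ν x * M s x)
      map_add' := fun μ μ' => by simp [add_mul, Finset.sum_add_distrib]
      map_smul' := fun a μ => by simp [Finset.mul_sum, mul_assoc] }
  obtain ⟨μ, hμ, ν, hν, h⟩ := Sion.exists_isSaddlePointOn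
    (f := fun (μ : S → ℝ) (ν : X → ℝ) => ∑ s, ∑ x, μ s * (ν x * M s x))
    ⟨_, single_mem_stdSimplex ℝ s₀⟩ (convex_stdSimplex ℝ S) (isCompact_stdSimplex ℝ S)
    (fun ν _ => (LinearMap.continuous_of_finiteDimensional (F' ν)).lowerSemicontinuous
      |>.lowerSemicontinuousOn _)
    (fun ν _ => ((F' ν).convexOn (convex_stdSimplex ℝ S)).quasiconvexOn)
    (convex_stdSimplex ℝ X) ⟨_, single_mem_stdSimplex ℝ (Classical.arbitrary X)⟩
    (isCompact_stdSimplex ℝ X)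
    (fun μ _ => (LinearMap.continuous_of_finiteDimensional (F μ)).upperSemicontinuous
      |>.upperSemicontinuousOn _)
    (fun μ _ => ((F μ).concaveOn (convex_stdSimplex ℝ X)).quasiconcaveOn)
  have hs : ∀ s, ∑ s', ∑ x, (Pi.single s 1 : S → ℝ) s' * (ν x * M s' x) = ∑ x, ν x * M s x := by
    intro s
    rw [Finset.sum_eq_single s (fun s' _ h => by simp [h]) (by simp)]
    simp
  have hx : ∀ x, ∑ s, ∑ x', μ s * ((Pi.single x 1 : X → ℝ) x' * M s x') = ∑ s, μ s * M s x := by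
    intro x
    refine Finset.sum_congr rfl fun s _ => ?_
    rw [Finset.sum_eq_single x (fun x' _ h => by simp [h]) (by simp)]
    simp
  rcases le_or_gt (∑ s, ∑ x, μ s * (ν x * M s x)) c with hc | hc
  · exact Or.inl ⟨μ, hμ, fun x => hx x ▸ (h μ hμ _ (single_mem_stdSimplex ℝ x)).trans hc⟩
  · exact Or.inr ⟨ν, hν, fun s => hs s ▸ hc.trans_le (h _ (single_mem_stdSimplex ℝ s) ν hν)⟩

/-- If a random bit `b x` is to be guessed from an observation `Y x`, then some deterministic guess
is at least as good as guessing `1` with probability `p (Y x)`. -/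
theorem exists_deterministic_guess {X Ω : Type*} [Fintype X] [Fintype Ω] (ν : X → ℝ)
    (b : X → Bool) (Y : X → Ω) (p : Ω → ℝ) (hp : ∀ y, p y ∈ Set.Icc (0 : ℝ) 1) :
    ∃ g : Ω → Bool, ∑ x, ν x * (if g (Y x) ≠ b x then 1 else 0) ≤
      ∑ x, ν x * (if b x = true then 1 - p (Y x) else p (Y x)) := by
  classical
  -- the advantage of the guess `1` over the guess `0` when `y` is observed
  let w (y : Ω) : ℝ := ∑ x with Y x = y, ν x * (if b x = true then 1 else -1)
  have key : ∀ q : Ω → ℝ, ∑ x, ν x * (if b x = true then 1 - q (Y x) else q (Y x)) =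
      ∑ x, ν x * (if b x = true then 1 else 0) - ∑ y, w y * q y := by
    intro q
    have : ∑ y, w y * q y = ∑ x, ν x * (if b x = true then 1 else -1) * q (Y x) := by
      rw [← Finset.sum_fiberwise Finset.univ Y]
      refine Finset.sum_congr rfl fun y _ => ?_
      rw [Finset.sum_mul]
      exact Finset.sum_congr rfl fun x hx => by rw [(Finset.mem_filter.1 hx).2]
    rw [this, ← Finset.sum_sub_distrib]
    exact Finset.sum_congr rfl fun x _ => by split_ifs <;> ring
  refine ⟨fun y => decide (0 ≤ w y), ?_⟩
  have h := key fun y => if 0 ≤ w y then 1 else 0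
  have hg : ∀ x, (if decide (0 ≤ w (Y x)) ≠ b x then (1 : ℝ) else 0) =
      if b x = true then 1 - (if 0 ≤ w (Y x) then 1 else 0) else if 0 ≤ w (Y x) then 1 else 0 := by
    intro x
    cases b x <;> by_cases hw : 0 ≤ w (Y x) <;> simp [hw]
  simp only [hg]
  rw [h, key]
  refine sub_le_sub_left (Finset.sum_le_sum fun y _ => ?_) _
  split_ifs with hw
  · exact mul_le_mul_of_nonneg_left (hp y).2 hw
  · rw [mul_zero]
    exact mul_nonpos_of_nonpos_of_nonneg (not_le.1 hw).le (hp y).1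

/-! ### Randomized query complexity -/

section Randomized

variable {n : ℕ} {A : Type} [Fintype A]

/-- A function that depends only on the positions in `S` is computed by a decision tree that queries
these positions. -/
theorem DecisionTree.exists_eval_eq (S : Finset (Fin n)) (F : (Fin n → A) → Bool)
    (hF : ∀ x y, (∀ i ∈ S, x i = y i) → F x = F y) :
    ∃ t : DecisionTree n A, t.depth ≤ S.card ∧ ∀ x, t.eval x = F x := by
  classical
  induction S using Finset.induction_on generalizing F with
  | empty =>
    by_cases h : Nonempty (Fin n → A)
    · exact ⟨leaf (F h.some), le_rfl, fun x => hF _ _ (by simp)⟩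
    · exact ⟨leaf true, le_rfl, fun x => (h ⟨x⟩).elim⟩
  | insert i S hi ih =>
    choose next hd he using fun a => ih (fun x => F (Function.update x i a)) fun x y hxy =>
      hF _ _ fun k hk => by
        by_cases hki : k = i
        · simp [hki]
        · simp [hki, hxy k ((Finset.mem_insert.1 hk).resolve_left hki)]
    refine ⟨query i next, ?_, fun x => by simp [eval, he]⟩
    rw [depth, Finset.card_insert_of_notMem hi, add_comm]
    exact Nat.succ_le_succ (Finset.sup_le fun a _ => hd a)

/-- A finite mixture of decision trees bounds the randomized query complexity. -/
theorem randomizedQueryComplexity_le {S : Type} [Fintype S] {μ : S → ℝ} (hμ : μ ∈ stdSimplex ℝ S)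
    (t : S → DecisionTree n A) {T : ℕ} (ht : ∀ s, (t s).depth ≤ T) (f : (Fin n → A) →. Bool)
    (ε : ℝ) (h : ∀ (x : Fin n → A) (hx : x ∈ f.Dom),
      ∑ s, μ s * (if (t s).eval x ≠ f.fn x hx then 1 else 0) ≤ ε) :
    randomizedQueryComplexity ε f ≤ T := by
  classical
  have hsum : ∑ s, ENNReal.ofReal (μ s) = 1 := by
    rw [← ENNReal.ofReal_sum_of_nonneg fun s _ => hμ.1 s, hμ.2, ENNReal.ofReal_one]
  refine iInf₂_le T ⟨(PMF.ofFintype _ hsum).map t, fun d hd => ?_, fun x hx => ?_⟩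
  · obtain ⟨s, -, rfl⟩ := (PMF.mem_support_map_iff _ _ _).1 hd
    exact ht s
  · rw [PMF.toOuterMeasure_map_apply, PMF.toOuterMeasure_apply_fintype,
      ENNReal.toReal_sum fun s _ => ?_]
    · refine le_trans (le_of_eq ?_) (h x hx)
      refine Finset.sum_congr rfl fun s _ => ?_
      simp only [Set.indicator, Set.mem_preimage, Set.mem_ofPred_eq, PMF.ofFintype_apply]
      split_ifs <;> simp [hμ.1 s]
    · exact ne_top_of_le_ne_top ENNReal.ofReal_ne_top
        (Set.indicator_le_self _ (fun s => ENNReal.ofReal (μ s)) s)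

theorem randomizedQueryComplexity_le_depth (f : (Fin n → A) →. Bool) (t : DecisionTree n A)
    (h : ∀ (x : Fin n → A) (hx : x ∈ f.Dom), t.eval x = f.fn x hx) :
    randomizedQueryComplexity (1 / 3) f ≤ t.depth :=
  randomizedQueryComplexity_le (S := Unit) (μ := fun _ => 1) (by simp [stdSimplex]) (fun _ => t)
    (fun _ => le_rfl) f _ fun x hx => by simp [h x hx]

theorem randomizedQueryComplexity_eq_zero_of_constant (f : (Fin n → A) →. Bool) (b : Bool)
    (h : ∀ (x : Fin n → A) (hx : x ∈ f.Dom), f.fn x hx = b) :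
    randomizedQueryComplexity (1 / 3) f = 0 :=
  le_antisymm (randomizedQueryComplexity_le_depth f (.leaf b) fun x hx => (h x hx).symm) zero_le

open Classical in
theorem DecisionTree.exists_computes (f : (Fin n → A) →. Bool) :
    ∃ t : DecisionTree n A, t.depth ≤ n ∧ ∀ (x : Fin n → A) (hx : x ∈ f.Dom),
      t.eval x = f.fn x hx := by
  obtain ⟨t, hd, ht⟩ := DecisionTree.exists_eval_eq (A := A) (Finset.univ : Finset (Fin n))
    (fun x => if hx : x ∈ f.Dom then f.fn x hx else true)
    fun x y h => by rw [show x = y from funext fun i => h i (Finset.mem_univ i)]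
  exact ⟨t, by simpa using hd, fun x hx => by rw [ht, dif_pos hx]⟩

/-! ### Quantum query complexity -/

theorem IsAcceptProb.quantumQueryComplexity_le {label : A ≃ Fin (Fintype.card A)} {T : ℕ}
    {p : (Fin n → A) → ℝ} (hp : IsAcceptProb label T p) (f : (Fin n → A) →. Bool) (ε : ℝ)
    (h₁ : ∀ (x : Fin n → A) (hx : x ∈ f.Dom), f.fn x hx = true → 1 - ε ≤ p x)
    (h₀ : ∀ (x : Fin n → A) (hx : x ∈ f.Dom), f.fn x hx = false → p x ≤ ε) :
    quantumQueryComplexity ε f ≤ T := by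
  obtain ⟨Q, -, rfl, hQ⟩ := hp
  refine iInf₂_le Q fun x hx => ?_
  have h := Q.outputProb_add_outputProb_not x true
  rw [hQ] at h
  cases hv : f.fn x hx
  · exact (hQ x).le.trans (h₀ x hx hv)
  · linarith [h₁ x hx hv]

theorem quantumQueryComplexity_le_length (f : (Fin n → A) →. Bool) :
    quantumQueryComplexity (1 / 3) f ≤ n := by
  obtain ⟨t, hd, ht⟩ := DecisionTree.exists_computes f
  refine ((t.isAcceptProb_eval (Fintype.equivFin A)).quantumQueryComplexity_le f (1 / 3)
    (fun x hx hv => ?_) fun x hx hv => ?_).trans (Nat.cast_le.2 hd)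
  · rw [ht x hx, hv]; norm_num
  · rw [ht x hx, hv]; norm_num

theorem exists_quantumAlgorithm_eq_complexity (f : (Fin n → A) →. Bool) :
    ∃ Q : QuantumAlgorithm n A, Q.Computes f (1 / 3) ∧
      quantumQueryComplexity (1 / 3) f = Q.queries := by
  have hne : Nonempty {Q : QuantumAlgorithm n A // Q.Computes f (1 / 3)} := by
    by_contra h
    rw [nonempty_subtype, not_exists] at h
    have := quantumQueryComplexity_le_length f
    rw [quantumQueryComplexity] at this
    simp only [h, iInf_false, iInf_top, top_le_iff, ENat.natCast_ne_top] at this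
  rw [quantumQueryComplexity, iInf_subtype']
  obtain ⟨Q, hQ⟩ := ciInf_mem fun Q : {Q : QuantumAlgorithm n A // Q.Computes f (1 / 3)} =>
    (Q.1.queries : ℕ∞)
  exact ⟨Q.1, Q.2, hQ.symm⟩

/-- An algorithm that makes no queries has the same output distribution on all inputs. -/
theorem QuantumAlgorithm.Computes.queries_pos {Q : QuantumAlgorithm n A}
    {f : (Fin n → A) →. Bool} (hQ : Q.Computes f (1 / 3)) {x y : Fin n → A} (hx : x ∈ f.Dom)
    (hy : y ∈ f.Dom) (hxy : f.fn x hx ≠ f.fn y hy) : 0 < Q.queries := by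
  by_contra! h0
  rw [Nat.le_zero] at h0
  have h : Q.outputProb x (!f.fn y hy) = Q.outputProb y (!f.fn y hy) := by
    simp only [outputProb, h0, state]
  have h₁ := hQ x hx
  have h₂ := hQ y hy
  have h₃ := Q.outputProb_add_outputProb_not x (f.fn y hy)
  rw [Bool.eq_not.2 hxy, Bool.not_not] at h₁
  linarith

end Randomized

/-! ### Amplification of the success probability -/

theorem majority_mono {a b : ℝ} (ha : 0 ≤ a) (hab : a ≤ b) (hb : b ≤ 1) :
    3 * a ^ 2 - 2 * a ^ 3 ≤ 3 * b ^ 2 - 2 * b ^ 3 := by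
  have h : 3 * b ^ 2 - 2 * b ^ 3 - (3 * a ^ 2 - 2 * a ^ 3) =
      (b - a) * (2 * (a * (1 - a)) + 2 * (b * (1 - b)) + a * (1 - b) + b * (1 - a)) := by ring
  have ha₁ : 0 ≤ 1 - a := by linarith
  have hb₁ : 0 ≤ 1 - b := by linarith
  have hb₀ : 0 ≤ b := ha.trans hab
  have : 0 ≤ 3 * b ^ 2 - 2 * b ^ 3 - (3 * a ^ 2 - 2 * a ^ 3) := by
    rw [h]
    exact mul_nonneg (sub_nonneg.2 hab) (by positivity)
  linarith

/-- Three rounds of majority votes bring an error probability of `1 / 3` below `1 / 9`. -/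
theorem majority_iterate_le {a b c d : ℝ} (ha : 0 ≤ a) (ha' : a ≤ 1 / 3)
    (hb : b = 3 * a ^ 2 - 2 * a ^ 3) (hc : c = 3 * b ^ 2 - 2 * b ^ 3)
    (hd : d = 3 * c ^ 2 - 2 * c ^ 3) : d ≤ 1 / 9 := by
  have hb₀ : 0 ≤ b := by
    rw [hb]
    simpa using majority_mono le_rfl ha (by linarith)
  have hb₁ : b ≤ 7 / 27 := by
    rw [hb]
    exact (majority_mono ha ha' (by norm_num)).trans (by norm_num)
  have hc₀ : 0 ≤ c := by
    rw [hc]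
    simpa using majority_mono le_rfl hb₀ (by linarith)
  have hc₁ : c ≤ 1 / 5 := by
    rw [hc]
    exact (majority_mono hb₀ hb₁ (by norm_num)).trans (by norm_num)
  rw [hd]
  exact (majority_mono hc₀ hc₁ (by norm_num)).trans (by norm_num)

theorem IsAcceptProb.exists_amplified {n : ℕ} {A : Type} [Fintype A]
    {label : A ≃ Fin (Fintype.card A)} {T : ℕ} {p : (Fin n → A) → ℝ}
    (hp : IsAcceptProb label T p) :
    ∃ q, IsAcceptProb label (27 * T) q ∧
      ∀ x, (p x ≤ 1 / 3 → q x ≤ 1 / 9) ∧ (1 - p x ≤ 1 / 3 → 1 - q x ≤ 1 / 9) := by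
  have h := hp.majority.majority.majority
  rw [show 3 * (3 * (3 * T)) = 27 * T by ring] at h
  refine ⟨_, h, fun x => ⟨fun hx => majority_iterate_le (hp.mem_Icc x).1 hx rfl rfl rfl,
    fun hx => majority_iterate_le (sub_nonneg.2 (hp.mem_Icc x).2) hx rfl rfl ?_⟩⟩
  ring

/-! ### Trading permutations for strings with few symbols -/

section Symmetric

variable {n : ℕ} {A : Type} [Fintype A]

/-- Let a quantum algorithm guess the bit `b x` from `y x ∘ α`. If its error probability is at most
`1 / 9` for `α ∈ G`, but for every `α` with at most `r` symbols exceeds `1 / 3` on average over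
`x ∼ ν`, then `α` can be classified by drawing `x ∼ ν` and checking whether the guess is correct.
Accepting only if three such checks succeed gives acceptance probability at least `(8 / 9) ^ 3` in
the first case and at most `(2 / 3) ^ 3` in the second. -/
theorem quantumQueryComplexity_distinguish_le [NeZero n] {label : A ≃ Fin (Fintype.card A)} {T : ℕ}
    {p : (Fin n → A) → ℝ} (hp : IsAcceptProb label T p) {X : Type} [Fintype X]
    (G : Subgroup (Equiv.Perm (Fin n))) (r : ℕ) (y : X → Fin n → A) (b : X → Bool) {ν : X → ℝ}
    (hν : ν ∈ stdSimplex ℝ X)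
    (hG : ∀ π ∈ G, ∀ x,
      (if b x = true then 1 - p (y x ∘ π) else p (y x ∘ π)) ≤ 1 / 9)
    (hr : ∀ α ∈ smallRange n r,
      1 / 3 < ∑ x, ν x * (if b x = true then 1 - p (y x ∘ α) else p (y x ∘ α))) :
    quantumQueryComplexity (1 / 3) (distinguish G r) ≤ (6 * T : ℕ) := by
  have : NeZero (Fintype.card (Fin n)) := ⟨by simpa using NeZero.ne n⟩
  let label' := Fintype.equivFin (Fin n)
  -- the error probability of the guess of `b x` from `y x ∘ α`
  let e (x : X) (α : Fin n → Fin n) : ℝ := if b x = true then 1 - p (y x ∘ α) else p (y x ∘ α)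
  have he : ∀ x, IsAcceptProb label' (2 * T) (e x) := fun x => by
    cases hb : b x
    · exact (hp.substitute label' (y x)).congr fun α => by simp [e, hb]
    · exact (hp.substitute label' (y x)).not.congr fun α => by simp [e, hb]
  have hmix : IsAcceptProb label' (2 * T) fun α => ∑ x, ν x * e x α :=
    IsAcceptProb.congr ((convex_isAcceptProb (2 * T)).sum_mem (fun x _ => hν.1 x) hν.2
      fun x _ => he x) fun α => by simp
  have hcube := hmix.not.and (hmix.not.and hmix.not)
  rw [show 2 * T + (2 * T + 2 * T) = 6 * T by ring] at hcube
  have hE₀ : ∀ α, ∑ x, ν x * e x α ≤ 1 := fun α => (hmix.mem_Icc α).2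
  refine hcube.quantumQueryComplexity_le _ _ (fun α hα hv => ?_) fun α hα hv => ?_
  · obtain ⟨π, hπ, rfl⟩ : α ∈ permStrings G := by simpa [distinguish, PFun.fn] using hv
    have hE : ∑ x, ν x * e x π ≤ 1 / 9 := by
      calc ∑ x, ν x * e x π ≤ ∑ x, ν x * (1 / 9) :=
            Finset.sum_le_sum fun x _ => mul_le_mul_of_nonneg_left (hG π hπ x) (hν.1 x)
        _ = 1 / 9 := by rw [← Finset.sum_mul, hν.2, one_mul]
    have h := pow_le_pow_left₀ (by norm_num) (show (8 : ℝ) / 9 ≤ 1 - ∑ x, ν x * e x π by linarith) 3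
    linarith
  · have hα' : α ∉ permStrings G := by simpa [distinguish, PFun.fn] using hv
    have hE : 1 / 3 < ∑ x, ν x * e x α := hr α (hα.resolve_left hα')
    have h := pow_le_pow_left₀ (sub_nonneg.2 (hE₀ α))
      (show 1 - ∑ x, ν x * e x α ≤ (2 : ℝ) / 3 by linarith) 3
    linarith

/-- Either `f` is computed by guessing `f x` from `x ∘ α`, for a suitable distribution of the guessing
rule and of the string `α` with at most `r` symbols, or the quantum algorithm for `f` distinguishes
such strings from the permutations in `G`. -/
theorem randomizedQueryComplexity_le_or_distinguish_le [NeZero n] (f : (Fin n → A) →. Bool)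
    (G : Subgroup (Equiv.Perm (Fin n))) (hf : SymmetricUnder f G) (r : ℕ)
    (hne : f.Dom.Nonempty) (Q : QuantumAlgorithm n A) (hQ : Q.Computes f (1 / 3)) :
    randomizedQueryComplexity (1 / 3) f ≤ r ∨
      quantumQueryComplexity (1 / 3) (distinguish G r) ≤ (162 * Q.queries : ℕ) := by
  classical
  obtain ⟨p, hp, hpQ⟩ := IsAcceptProb.exists_amplified ⟨Q, rfl, rfl, fun _ => rfl⟩
  have hperr : ∀ (x : Fin n → A) (hx : x ∈ f.Dom),
      (if f.fn x hx = true then 1 - p x else p x) ≤ 1 / 9 := by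
    intro x hx
    have h := hQ x hx
    cases hv : f.fn x hx <;> rw [hv] at h
    · exact (hpQ x).1 h
    · refine (hpQ x).2 (le_trans (le_of_eq ?_) h)
      rw [← Q.outputProb_add_outputProb_not x true]
      simp
  let X := {x : Fin n → A // x ∈ f.Dom}
  have : Nonempty X := hne.to_subtype
  -- the pure strategies of the classical player: substitute `α`, then guess according to `g`
  let S := {α : Fin n → Fin n // α ∈ smallRange n r} × ((Fin n → A) → Bool)
  rcases exists_stdSimplex_le_or_lt (S := S) (X := X)
    (fun s x => if s.2 (x.1 ∘ s.1.1) ≠ f.fn x.1 x.2 then (1 : ℝ) else 0) (1 / 3) with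
    ⟨μ, hμ, h⟩ | ⟨ν, hν, h⟩
  · left
    choose t hd ht using fun s : S => DecisionTree.exists_eval_eq
      (Finset.univ.image s.1.1) (fun x : Fin n → A => s.2 (x ∘ s.1.1))
      fun x y hxy => congrArg s.2 (funext fun i => hxy _ (Finset.mem_image_of_mem _ (by simp)))
    refine randomizedQueryComplexity_le hμ t (fun s => (hd s).trans ?_) f _ fun x hx => ?_
    · have hs : (Set.range s.1.1).ncard ≤ r := s.1.2
      rwa [← Set.ncard_coe_finset, Finset.coe_image, Finset.coe_univ, Set.image_univ]
    · simpa only [ht] using h ⟨x, hx⟩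
  · right
    have h' := quantumQueryComplexity_distinguish_le hp G r (fun x : X => x.1)
      (fun x => f.fn x.1 x.2) hν (fun π hπ x => ?_) fun α hα => ?_
    · rwa [← mul_assoc] at h'
    · obtain ⟨hx, hfx⟩ := hf x.1 x.2 π hπ
      rw [← hfx]
      exact hperr _ hx
    · obtain ⟨g, hg⟩ := exists_deterministic_guess ν (fun x : X => f.fn x.1 x.2)
        (fun x => x.1 ∘ α) p hp.mem_Icc
      exact (h ⟨⟨α, hα⟩, g⟩).trans_le hg

/-- The constant `163` exceeds `162 = 27 * 6`: amplification costs a factor `27`, substitution a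
factor `2`, and the threefold repetition a factor `3`. -/
theorem randomizedQueryComplexity_le_of_le_cost (f : (Fin n → A) →. Bool)
    (G : Subgroup (Equiv.Perm (Fin n))) (hf : SymmetricUnder f G) {r : ℕ}
    (hr : ((163 : ℕ) : ℕ∞) * quantumQueryComplexity (1 / 3) f ≤ cost (1 / 3) G r) :
    randomizedQueryComplexity (1 / 3) f ≤ r := by
  by_cases hconst : ∃ b, ∀ (x : Fin n → A) (hx : x ∈ f.Dom), f.fn x hx = b
  · obtain ⟨b, hb⟩ := hconst
    rw [randomizedQueryComplexity_eq_zero_of_constant f b hb]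
    exact zero_le
  push Not at hconst
  -- so `f` takes both values; hence `0 < n` and at least one query is needed
  obtain ⟨x, hx, hxv⟩ := hconst true
  obtain ⟨y, hy, hyv⟩ := hconst false
  have hxy : f.fn x hx ≠ f.fn y hy := by
    simp_all
  have : NeZero n := ⟨by
    rintro rfl
    exact hxy (by congr 1; exact Subsingleton.elim x y)⟩
  rcases le_or_gt n r with hnr | hnr
  · obtain ⟨t, hd, ht⟩ := DecisionTree.exists_computes f
    exact (randomizedQueryComplexity_le_depth f t ht).trans (Nat.cast_le.2 (hd.trans hnr))
  obtain ⟨Q, hQ, hQf⟩ := exists_quantumAlgorithm_eq_complexity f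
  refine (randomizedQueryComplexity_le_or_distinguish_le f G hf r ⟨x, hx⟩ Q hQ).resolve_right
    fun h => ?_
  rw [cost, if_pos hnr, hQf, ← Nat.cast_mul] at hr
  have hpos := hQ.queries_pos hx hy hxy
  have := Nat.cast_le.1 (hr.trans h)
  lia

end Symmetric

/-! ### Bounds in terms of the cost and for well-shuffling collections -/

theorem mainTheorem3 :
    (∃ c : ℕ, 0 < c ∧
      ∀ (n : ℕ) (A : Type) [Fintype A] (f : (Fin n → A) →. Bool)
        (G : Subgroup (Equiv.Perm (Fin n))), SymmetricUnder f G →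
        ∃ r : ℕ, IsLeast {r : ℕ | (c : ℕ∞) * quantumQueryComplexity (1 / 3) f ≤ cost (1 / 3) G r} r ∧
          randomizedQueryComplexity (1 / 3) f ≤ (r : ℕ∞)) ∧
    (∀ (𝒢 : ActionCollection) (a : ℕ), WellShuffling 𝒢 a →
      ∃ C : ℕ, ∀ (n : ℕ) (A : Type) [Fintype A] (f : (Fin n → A) →. Bool),
        InSymmetricClass 𝒢 f →
        randomizedQueryComplexity (1 / 3) f ≤ (C : ℕ∞) * quantumQueryComplexity (1 / 3) f ^ a) := by
  refine ⟨⟨163, by norm_num, fun n A _ f G hf => ?_⟩, ?_⟩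
  · have hne : {r : ℕ | ((163 : ℕ) : ℕ∞) * quantumQueryComplexity (1 / 3) f ≤
        cost (1 / 3) G r}.Nonempty := ⟨n, by simp [cost]⟩
    exact ⟨_, ⟨Nat.sInf_mem hne, fun r hr => Nat.sInf_le hr⟩,
      randomizedQueryComplexity_le_of_le_cost f G hf (Nat.sInf_mem hne)⟩
  · rintro 𝒢 a ⟨ha, b, hb, h⟩
    refine ⟨(b * 163) ^ a, fun n A _ f ⟨G, hG, hf⟩ => ?_⟩
    obtain ⟨Q, -, hQ⟩ := exists_quantumAlgorithm_eq_complexity f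
    -- for this `r` the lower bound `r ^ (1 / a) / b` on the cost equals `163 * Q.queries`
    have hr := h n G hG ((b * 163 * Q.queries) ^ a)
    have hroot : ((((b * 163 * Q.queries) ^ a : ℕ) : ℝ) ^ ((1 : ℝ) / a)) / b =
        ((163 * Q.queries : ℕ) : ℝ) := by
      have hb' : (b : ℝ) ≠ 0 := Nat.cast_ne_zero.2 hb.ne'
      rw [Nat.cast_pow, one_div, Real.pow_rpow_inv_natCast (Nat.cast_nonneg _) ha.ne']
      push_cast
      field_simp
    rw [hroot, ENNReal.ofReal_natCast, ← ENat.toENNReal_coe, ENat.toENNReal_le] at hr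
    refine (randomizedQueryComplexity_le_of_le_cost f G hf
      (r := (b * 163 * Q.queries) ^ a) ?_).trans (le_of_eq ?_)
    · rw [hQ]
      exact_mod_cast hr
    · rw [hQ]
      push_cast
      ring
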